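/- Let $(M,g)$ be a semi-Riemannian manifold with Levi-Civita connection $\overline\nabla$, and let $\sigma\subset \mathrm{End}(TM)$ be an almost paraquaternionic structure, i.e. a rank-3 subbundle which near every point has a smooth local basis $\{J_1,J_2,J_3\}$ (a canonical local basis) with $$J_\alpha^2=-\epsilon_\alpha\,\mathrm{Id},\qquad J_\alpha J_{\alpha+1}=-J_{\alpha+1}J_\alpha=\epsilon_{\alpha+2}J_{\alpha+2},\qquad \epsilon_1=1,\ \epsilon_2=\epsilon_3=-1,$$ indices modulo 3. Suppose that $(M,\sigma,g)$ is a paraquaternionic Kähler manifold: $g(J_\alpha X,J_\alpha Y)=\epsilon_\alpha g(X,Y)$ for every canonical local basis, and $\sigma$ is parallel with respect to $\overline\nabla$. Let $N$ be a paraquaternionic CR-submanifold of $M$: an immersed submanifold on which the induced metric (again denoted $g$) is non-degenerate, with a smooth distribution $\mathcal D\subseteq TN$, non-degenerate for $g$, such that for every canonical local basis $\{J_\alpha\}$ and every point $x$ of $N$ in its domain $$J_\alpha\mathcal D_x=\mathcal D_x,\qquad J_\alpha\mathcal D_x^\perp\subseteq T_xN^\perp\qquad(\alpha=1,2,3),$$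 where $\mathcal D^\perp$ is the orthogonal complement of $\mathcal D$ in $TN$. Let $\nabla$ be the Levi-Civita connection of $N$, and for local sections $X,Y$ of $\mathcal D$ let $h^{\mathcal D}(X,Y)$ be the $\mathcal D^\perp$-component of $\nabla_XY$. Then $\mathcal D$ is minimal, i.e. its mean curvature vector $$H^{\mathcal D}=\frac1q\sum_{i=1}^q g(E_i,E_i)\,h^{\mathcal D}(E_i,E_i),\qquad q=\dim\mathcal D,\quad \{E_i\}\text{ a pseudo-orthonormal basis of }\mathcal D,$$ vanishes identically (for $q=0$ we put $H^{\mathcal D}=0$). Moreover $h^{\mathcal D}(X,X)=0$ for every local section $X$ of $\mathcal D$. -/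

import Mathlib

open Bundle VectorField Module
open scoped Manifold ContDiff Topology

noncomputable section

section Metric

variable {E : Type*} [NormedAddCommGroup E] [NormedSpace ℝ E]
  {M : Type*} [TopologicalSpace M] [ChartedSpace E M] [IsManifold 𝓘(ℝ, E) ∞ M]

variable (E M) in
/-- A semi-Riemannian metric: a smooth field of nondegenerate symmetric bilinear forms. -/
structure SemiRiemannianMetric where
  inner (x : M) : TangentSpace 𝓘(ℝ, E) x →L[ℝ] TangentSpace 𝓘(ℝ, E) x →L[ℝ] ℝ
  symm (x : M) (v w : TangentSpace 𝓘(ℝ, E) x) : inner x v w = inner x w v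
  nondegenerate (x : M) (v : TangentSpace 𝓘(ℝ, E) x) (hv : ∀ w, inner x v w = 0) : v = 0
  contMDiff : ContMDiff 𝓘(ℝ, E) (𝓘(ℝ, E).prod 𝓘(ℝ, E →L[ℝ] E →L[ℝ] ℝ)) ∞
    (fun x ↦ TotalSpace.mk' (E →L[ℝ] E →L[ℝ] ℝ)
      (E := fun x : M ↦ TangentSpace 𝓘(ℝ, E) x →L[ℝ] TangentSpace 𝓘(ℝ, E) x →L[ℝ] ℝ) x (inner x))

/-- A connection is a Levi-Civita connection of `g` if it is metric and torsion free. -/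
structure IsLeviCivita (g : SemiRiemannianMetric E M)
    (cov : CovariantDerivative 𝓘(ℝ, E) E (TangentSpace 𝓘(ℝ, E) : M → Type _)) : Prop where
  metric {x : M} {Y Z : Π x : M, TangentSpace 𝓘(ℝ, E) x} (v : TangentSpace 𝓘(ℝ, E) x)
    (hY : MDiffAt (T% Y) x) (hZ : MDiffAt (T% Z) x) :
    d% (fun y ↦ g.inner y (Y y) (Z y)) x v =
      g.inner x (cov Y x v) (Z x) + g.inner x (Y x) (cov Z x v)
  torsionFree {x : M} {X Y : Π x : M, TangentSpace 𝓘(ℝ, E) x}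
    (hX : MDiffAt (T% X) x) (hY : MDiffAt (T% Y) x) :
    cov Y x (X x) - cov X x (Y x) = mlieBracket 𝓘(ℝ, E) X Y x

variable (g : SemiRiemannianMetric E M)

namespace SemiRiemannianMetric

theorem mdifferentiableAt_inner {x : M} {Y Z : Π x : M, TangentSpace 𝓘(ℝ, E) x}
    (hY : MDiffAt (T% Y) x) (hZ : MDiffAt (T% Z) x) :
    MDiffAt (fun y ↦ g.inner y (Y y) (Z y)) x := by
  have h1 := (g.contMDiff x).mdifferentiableAt (by simp)
  have : MDifferentiableAt 𝓘(ℝ, E) (𝓘(ℝ, E).prod 𝓘(ℝ))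
      (fun m ↦ TotalSpace.mk' ℝ (E := Bundle.Trivial M ℝ) m (g.inner m (Y m) (Z m))) x := by
    apply MDifferentiableAt.clm_bundle_apply₂ (F₁ := E) (F₂ := E)
    · exact h1
    · exact hY
    · exact hZ
  rw [mdifferentiableAt_totalSpace] at this
  exact this.2

theorem inner_right_injective {x : M} {u v : TangentSpace 𝓘(ℝ, E) x}
    (h : ∀ w, g.inner x u w = g.inner x v w) : u = v := by
  rw [← sub_eq_zero]
  apply g.nondegenerate x
  intro w
  simp [h]

/-- The metric at a point as a bilinear form. -/
def bilin (x : M) : LinearMap.BilinForm ℝ (TangentSpace 𝓘(ℝ, E) x) :=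
  LinearMap.mk₂ ℝ (fun v w ↦ g.inner x v w) (by simp) (by simp) (by simp) (by simp)

@[simp]
theorem bilin_apply (x : M) (v w : TangentSpace 𝓘(ℝ, E) x) : g.bilin x v w = g.inner x v w := rfl

theorem bilin_isSymm (x : M) : (g.bilin x).IsSymm := ⟨fun v w ↦ g.symm x v w⟩

/-- The Koszul expression, equal to `2 g(∇_X Y, Z)` for the Levi-Civita connection `∇`. -/
def koszul (X Y Z : Π x : M, TangentSpace 𝓘(ℝ, E) x) (x : M) : ℝ :=
  d% (fun y ↦ g.inner y (Y y) (Z y)) x (X x) + d% (fun y ↦ g.inner y (X y) (Z y)) x (Y x)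
    - d% (fun y ↦ g.inner y (X y) (Y y)) x (Z x)
    + g.inner x (mlieBracket 𝓘(ℝ, E) X Y x) (Z x) - g.inner x (mlieBracket 𝓘(ℝ, E) X Z x) (Y x)
    - g.inner x (mlieBracket 𝓘(ℝ, E) Y Z x) (X x)

section aux
variable {x : M} {X X' Y Y' Z : Π x : M, TangentSpace 𝓘(ℝ, E) x} {f : M → ℝ}

theorem mvfderiv_inner_smul_left (hf : MDiffAt f x) (hX : MDiffAt (T% X) x)
    (hY : MDiffAt (T% Y) x) (v : TangentSpace 𝓘(ℝ, E) x) :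
    d% (fun y ↦ g.inner y ((f • X) y) (Y y)) x v =
      f x * d% (fun y ↦ g.inner y (X y) (Y y)) x v + d% f x v * g.inner x (X x) (Y x) := by
  have : (fun y ↦ g.inner y ((f • X) y) (Y y)) = f * (fun y ↦ g.inner y (X y) (Y y)) := by
    ext y; simp
  rw [this, mvfderiv_mul hf (g.mdifferentiableAt_inner hX hY)]
  simp [mul_comm]

theorem mvfderiv_inner_smul_right (hf : MDiffAt f x) (hX : MDiffAt (T% X) x)
    (hY : MDiffAt (T% Y) x) (v : TangentSpace 𝓘(ℝ, E) x) :
    d% (fun y ↦ g.inner y (X y) ((f • Y) y)) x v =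
      f x * d% (fun y ↦ g.inner y (X y) (Y y)) x v + d% f x v * g.inner x (X x) (Y x) := by
  have : (fun y ↦ g.inner y (X y) ((f • Y) y)) = f * (fun y ↦ g.inner y (X y) (Y y)) := by
    ext y; simp
  rw [this, mvfderiv_mul hf (g.mdifferentiableAt_inner hX hY)]
  simp [mul_comm]

theorem mvfderiv_inner_add_left (hX : MDiffAt (T% X) x) (hX' : MDiffAt (T% X') x)
    (hY : MDiffAt (T% Y) x) (v : TangentSpace 𝓘(ℝ, E) x) :
    d% (fun y ↦ g.inner y ((X + X') y) (Y y)) x v =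
      d% (fun y ↦ g.inner y (X y) (Y y)) x v + d% (fun y ↦ g.inner y (X' y) (Y y)) x v := by
  have : (fun y ↦ g.inner y ((X + X') y) (Y y)) =
      (fun y ↦ g.inner y (X y) (Y y)) + (fun y ↦ g.inner y (X' y) (Y y)) := by
    ext y; simp
  rw [this, mvfderiv_add (g.mdifferentiableAt_inner hX hY) (g.mdifferentiableAt_inner hX' hY)]
  simp

theorem mvfderiv_inner_add_right (hX : MDiffAt (T% X) x) (hX' : MDiffAt (T% X') x)
    (hY : MDiffAt (T% Y) x) (v : TangentSpace 𝓘(ℝ, E) x) :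
    d% (fun y ↦ g.inner y (Y y) ((X + X') y)) x v =
      d% (fun y ↦ g.inner y (Y y) (X y)) x v + d% (fun y ↦ g.inner y (Y y) (X' y)) x v := by
  have : (fun y ↦ g.inner y (Y y) ((X + X') y)) =
      (fun y ↦ g.inner y (Y y) (X y)) + (fun y ↦ g.inner y (Y y) (X' y)) := by
    ext y; simp
  rw [this, mvfderiv_add (g.mdifferentiableAt_inner hY hX) (g.mdifferentiableAt_inner hY hX')]
  simp

variable [FiniteDimensional ℝ E]

theorem tensorialAt_koszul_left (hY : MDiffAt (T% Y) x) (hZ : MDiffAt (T% Z) x) :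
    TensorialAt 𝓘(ℝ, E) E (fun X ↦ g.koszul X Y Z x) x := by
  have : CompleteSpace E := FiniteDimensional.complete ℝ E
  constructor
  · intro f X hf hX
    simp only [koszul, g.mvfderiv_inner_smul_left hf hX hZ, g.mvfderiv_inner_smul_left hf hX hY,
      mlieBracket_smul_left hf hX]
    simp
    ring
  · intro X X' hX hX'
    simp only [koszul, g.mvfderiv_inner_add_left hX hX' hZ, g.mvfderiv_inner_add_left hX hX' hY,
      mlieBracket_add_left hX hX']
    simp
    ring

theorem tensorialAt_koszul_right (hX : MDiffAt (T% X) x) (hY : MDiffAt (T% Y) x) :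
    TensorialAt 𝓘(ℝ, E) E (fun Z ↦ g.koszul X Y Z x) x := by
  have : CompleteSpace E := FiniteDimensional.complete ℝ E
  constructor
  · intro f Z hf hZ
    simp only [koszul, g.mvfderiv_inner_smul_right hf hX hZ, g.mvfderiv_inner_smul_right hf hY hZ,
      mlieBracket_smul_right hf hZ]
    simp
    rw [g.symm x (Y x) (Z x), g.symm x (Z x) (X x)]
    ring
  · intro Z Z' hZ hZ'
    simp only [koszul, g.mvfderiv_inner_add_right hZ hZ' hX, g.mvfderiv_inner_add_right hZ hZ' hY,
      mlieBracket_add_right hZ hZ']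
    simp
    ring

theorem koszul_add (hX : MDiffAt (T% X) x) (hY : MDiffAt (T% Y) x) (hY' : MDiffAt (T% Y') x)
    (hZ : MDiffAt (T% Z) x) :
    g.koszul X (Y + Y') Z x = g.koszul X Y Z x + g.koszul X Y' Z x := by
  have : CompleteSpace E := FiniteDimensional.complete ℝ E
  simp only [koszul, g.mvfderiv_inner_add_right hY hY' hX, g.mvfderiv_inner_add_left hY hY' hZ,
      mlieBracket_add_right hY hY', mlieBracket_add_left hY hY']
  simp
  ring

theorem koszul_smul (hf : MDiffAt f x) (hX : MDiffAt (T% X) x) (hY : MDiffAt (T% Y) x)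
    (hZ : MDiffAt (T% Z) x) :
    g.koszul X (f • Y) Z x =
      f x * g.koszul X Y Z x + 2 * (d% f x (X x) * g.inner x (Y x) (Z x)) := by
  have : CompleteSpace E := FiniteDimensional.complete ℝ E
  simp only [koszul, g.mvfderiv_inner_smul_right hf hX hY, g.mvfderiv_inner_smul_left hf hY hZ,
      mlieBracket_smul_right hf hY, mlieBracket_smul_left hf hY]
  simp
  rw [g.symm x (Y x) (X x)]
  ring

end aux

variable [FiniteDimensional ℝ E]

instance finiteDimensional_tangentSpace (x : M) :
    FiniteDimensional ℝ (TangentSpace 𝓘(ℝ, E) x) :=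
  inferInstanceAs (FiniteDimensional ℝ E)

theorem exists_inner_eq (x : M) (φ : TangentSpace 𝓘(ℝ, E) x →ₗ[ℝ] ℝ) :
    ∃ v, ∀ w, g.inner x v w = φ w := by
  let L : TangentSpace 𝓘(ℝ, E) x →ₗ[ℝ] Dual ℝ (TangentSpace 𝓘(ℝ, E) x) :=
    { toFun := fun v ↦ (g.inner x v : TangentSpace 𝓘(ℝ, E) x →ₗ[ℝ] ℝ)
      map_add' := fun v w ↦ by ext; simp
      map_smul' := fun c v ↦ by ext; simp }
  have hL : Function.Injective L := by
    rw [injective_iff_map_eq_zero]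
    intro v hv
    exact g.nondegenerate x v fun w ↦ congrArg (fun ψ : Dual ℝ _ ↦ ψ w) hv
  obtain ⟨v, hv⟩ := (LinearMap.injective_iff_surjective_of_finrank_eq_finrank
    (Subspace.dual_finrank_eq).symm).1 hL φ
  exact ⟨v, fun w ↦ congrArg (fun ψ : Dual ℝ _ ↦ ψ w) hv⟩

theorem exists_koszul_repr {x : M} {Y : Π x : M, TangentSpace 𝓘(ℝ, E) x}
    (hY : MDiffAt (T% Y) x) :
    ∃ L : TangentSpace 𝓘(ℝ, E) x →L[ℝ] TangentSpace 𝓘(ℝ, E) x,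
      ∀ X Z : Π x : M, TangentSpace 𝓘(ℝ, E) x, MDiffAt (T% X) x → MDiffAt (T% Z) x →
        2 * g.inner x (L (X x)) (Z x) = g.koszul X Y Z x := by
  let B := TensorialAt.mkHom₂ (I := 𝓘(ℝ, E)) (F := E) (F' := E) (fun X Z ↦ g.koszul X Y Z x) x
    (fun Z hZ ↦ g.tensorialAt_koszul_left hY hZ) (fun X hX ↦ g.tensorialAt_koszul_right hX hY)
  have hB : ∀ u : TangentSpace 𝓘(ℝ, E) x, ∃ v, ∀ w, g.inner x v w = B u w := fun u ↦
    g.exists_inner_eq x (B u)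
  choose s hs using hB
  let L : TangentSpace 𝓘(ℝ, E) x →ₗ[ℝ] TangentSpace 𝓘(ℝ, E) x :=
    { toFun := s
      map_add' := fun u v ↦ g.inner_right_injective fun w ↦ by simp [hs]
      map_smul' := fun c v ↦ g.inner_right_injective fun w ↦ by simp [hs] }
  have : T2Space (TangentSpace 𝓘(ℝ, E) x) := inferInstanceAs (T2Space E)
  refine ⟨(1 / 2 : ℝ) • LinearMap.toContinuousLinearMap L, fun X Z hX hZ ↦ ?_⟩
  have h1 : g.inner x (s (X x)) (Z x) = g.koszul X Y Z x := by
    rw [hs]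
    exact TensorialAt.mkHom₂_apply _ _ hX hZ
  rw [← h1]
  simp [L]

/-- The fundamental theorem of semi-Riemannian geometry, existence. -/
theorem exists_isLeviCivita :
    ∃ cov : CovariantDerivative 𝓘(ℝ, E) E (TangentSpace 𝓘(ℝ, E) : M → Type _),
      IsLeviCivita g cov := by
  classical
  have : CompleteSpace E := FiniteDimensional.complete ℝ E
  let c (Y : Π x : M, TangentSpace 𝓘(ℝ, E) x) (x : M) :
      TangentSpace 𝓘(ℝ, E) x →L[ℝ] TangentSpace 𝓘(ℝ, E) x :=
    if hY : MDiffAt (T% Y) x then (g.exists_koszul_repr hY).choose else 0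
  have hc {x : M} {X Y Z : Π x : M, TangentSpace 𝓘(ℝ, E) x} (hX : MDiffAt (T% X) x)
      (hY : MDiffAt (T% Y) x) (hZ : MDiffAt (T% Z) x) :
      2 * g.inner x (c Y x (X x)) (Z x) = g.koszul X Y Z x := by
    simp only [c, hY, dif_pos]
    exact (g.exists_koszul_repr hY).choose_spec X Z hX hZ
  have hext {x : M} (v : TangentSpace 𝓘(ℝ, E) x) :
      ∃ X : Π x : M, TangentSpace 𝓘(ℝ, E) x, MDiffAt (T% X) x ∧ X x = v :=
    ⟨FiberBundle.extend E v, FiberBundle.mdifferentiableAt_extend .., by simp⟩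
  refine ⟨⟨c, ?_, ?_⟩, ?_, ?_⟩
  · intro Y Y' x hY hY' _
    ext v
    apply g.inner_right_injective
    intro w
    obtain ⟨X, hX, rfl⟩ := hext v
    obtain ⟨Z, hZ, rfl⟩ := hext w
    have h := hc hX (mdifferentiableAt_add_section hY hY') hZ
    rw [g.koszul_add hX hY hY' hZ, ← hc hX hY hZ, ← hc hX hY' hZ] at h
    simp only [add_apply, map_add]
    linarith
  · intro Y f x hY hf _
    ext v
    apply g.inner_right_injective
    intro w
    obtain ⟨X, hX, rfl⟩ := hext v
    obtain ⟨Z, hZ, rfl⟩ := hext w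
    have h := hc hX (hf.smul_section hY) hZ
    rw [g.koszul_smul hf hX hY hZ, ← hc hX hY hZ] at h
    simp only [add_apply, map_add, ContinuousLinearMap.smulRight_apply, map_smul, smul_apply,
      smul_eq_mul]
    linarith
  · intro x Y Z v hY hZ
    obtain ⟨X, hX, rfl⟩ := hext v
    have h1 := hc hX hY hZ
    have h2 := hc hX hZ hY
    have h3 : g.inner x (Y x) (c Z x (X x)) = g.inner x (c Z x (X x)) (Y x) := g.symm ..
    change _ = g.inner x (c Y x (X x)) (Z x) + g.inner x (Y x) (c Z x (X x))
    rw [h3]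
    simp only [koszul] at h1 h2
    have e : (fun y ↦ g.inner y (Z y) (Y y)) = (fun y ↦ g.inner y (Y y) (Z y)) := by
      ext y; exact g.symm ..
    rw [e, mlieBracket_swap_apply (V := Z) (W := Y)] at h2
    simp only [map_neg, neg_apply] at h2
    linarith
  · intro x X Y hX hY
    apply g.inner_right_injective
    intro w
    obtain ⟨Z, hZ, rfl⟩ := hext w
    have h1 := hc hX hY hZ
    have h2 := hc hY hX hZ
    change g.inner x (c Y x (X x) - c X x (Y x)) (Z x) = _
    simp only [koszul] at h1 h2
    have e : (fun y ↦ g.inner y (Y y) (X y)) = (fun y ↦ g.inner y (X y) (Y y)) := by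
      ext y; exact g.symm ..
    rw [e, mlieBracket_swap_apply (V := Y) (W := X)] at h2
    simp only [map_neg, map_sub, neg_apply, sub_apply] at h2 ⊢
    linarith

/-- The Levi-Civita connection of a semi-Riemannian metric. -/
def leviCivita : CovariantDerivative 𝓘(ℝ, E) E (TangentSpace 𝓘(ℝ, E) : M → Type _) :=
  g.exists_isLeviCivita.choose

theorem isLeviCivita_leviCivita : IsLeviCivita g g.leviCivita :=
  g.exists_isLeviCivita.choose_spec

/-- The fundamental theorem of semi-Riemannian geometry, uniqueness. -/
theorem eq_leviCivita {cov : CovariantDerivative 𝓘(ℝ, E) E (TangentSpace 𝓘(ℝ, E) : M → Type _)}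
    (h : IsLeviCivita g cov) {x : M} {Y : Π x : M, TangentSpace 𝓘(ℝ, E) x}
    (hY : MDiffAt (T% Y) x) : cov Y x = g.leviCivita Y x := by
  have key {cov : CovariantDerivative 𝓘(ℝ, E) E (TangentSpace 𝓘(ℝ, E) : M → Type _)}
      (h : IsLeviCivita g cov) {X Z : Π x : M, TangentSpace 𝓘(ℝ, E) x} (hX : MDiffAt (T% X) x)
      (hZ : MDiffAt (T% Z) x) : 2 * g.inner x (cov Y x (X x)) (Z x) = g.koszul X Y Z x := by
    rw [koszul, h.metric _ hY hZ, h.metric _ hX hZ, h.metric _ hX hY, ← h.torsionFree hX hY,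
      ← h.torsionFree hX hZ, ← h.torsionFree hY hZ]
    simp only [map_sub, sub_apply]
    rw [g.symm x (Y x), g.symm x (X x) (cov Z x _), g.symm x (X x) (cov Y x _)]
    ring
  ext v
  apply g.inner_right_injective
  intro w
  have hX := FiberBundle.mdifferentiableAt_extend (I := 𝓘(ℝ, E)) (F := E) v
  have hZ := FiberBundle.mdifferentiableAt_extend (I := 𝓘(ℝ, E)) (F := E) w
  have h1 := key h hX hZ
  have h2 := key g.isLeviCivita_leviCivita hX hZ
  simp only [FiberBundle.extend_apply_self] at h1 h2
  linarith

end SemiRiemannianMetric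

/-! ### Distributions -/

variable (E M) in
/-- A smooth distribution: near every point it is spanned by pointwise linearly independent smooth
vector fields. -/
structure TangentDistribution where
  fiber (x : M) : Submodule ℝ (TangentSpace 𝓘(ℝ, E) x)
  exists_frame (x₀ : M) : ∃ U : Set M, IsOpen U ∧ x₀ ∈ U ∧
    ∃ (q : ℕ) (X : Fin q → Π x : M, TangentSpace 𝓘(ℝ, E) x),
      (∀ i, CMDiff[U] ∞ (T% (X i))) ∧
      ∀ x ∈ U, LinearIndependent ℝ (fun i ↦ X i x) ∧
        fiber x = Submodule.span ℝ (Set.range fun i ↦ X i x)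

namespace TangentDistribution

variable (D : TangentDistribution E M)

/-- `X` is a smooth section of `D` over the set `U`. -/
structure IsSectionOn (U : Set M) (X : Π x : M, TangentSpace 𝓘(ℝ, E) x) : Prop where
  contMDiffOn : CMDiff[U] ∞ (T% X)
  mem (x : M) (hx : x ∈ U) : X x ∈ D.fiber x

/-- `D` is nondegenerate if the metric restricts to a nondegenerate form on each `D_x`. -/
def IsNondegenerate : Prop :=
  ∀ x, ∀ v ∈ D.fiber x, (∀ w ∈ D.fiber x, g.inner x v w = 0) → v = 0

/-- The orthogonal complement of `D_x` in the tangent space. -/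
def orthogonal (x : M) : Submodule ℝ (TangentSpace 𝓘(ℝ, E) x) :=
  (g.bilin x).orthogonal (D.fiber x)

theorem mem_orthogonal_iff {x : M} {v : TangentSpace 𝓘(ℝ, E) x} :
    v ∈ D.orthogonal g x ↔ ∀ w ∈ D.fiber x, g.inner x w v = 0 :=
  Iff.rfl

variable {g D}

theorem IsNondegenerate.restrict_nondegenerate (hD : D.IsNondegenerate g) (x : M) :
    ((g.bilin x).restrict (D.fiber x)).Nondegenerate := by
  constructor
  · rintro ⟨v, hv⟩ h
    exact Subtype.ext (hD x v hv fun w hw ↦ h ⟨w, hw⟩)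
  · rintro ⟨v, hv⟩ h
    exact Subtype.ext (hD x v hv fun w hw ↦ (g.symm x v w).trans (h ⟨w, hw⟩))

variable [FiniteDimensional ℝ E]

theorem IsNondegenerate.isCompl (hD : D.IsNondegenerate g) (x : M) :
    IsCompl (D.fiber x) (D.orthogonal g x) :=
  LinearMap.BilinForm.isCompl_orthogonal_of_restrict_nondegenerate
    (g.bilin_isSymm x).isRefl (hD.restrict_nondegenerate x)

/-- The second fundamental form `h(X, Y)` of a nondegenerate distribution: the component of
`∇_X Y` in the orthogonal complement of `D`. -/
def secondFundamentalForm (hD : D.IsNondegenerate g) (X Y : Π x : M, TangentSpace 𝓘(ℝ, E) x)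
    (x : M) : TangentSpace 𝓘(ℝ, E) x :=
  (D.orthogonal g x).projection (D.fiber x) (hD.isCompl x).symm (g.leviCivita Y x (X x))

variable (g D) in
/-- `e` is a pseudo-orthonormal basis of `D_x`. -/
structure IsPseudoOrthonormalBasis (x : M) {q : ℕ} (e : Fin q → TangentSpace 𝓘(ℝ, E) x) :
    Prop where
  orthogonal (i j : Fin q) (hij : i ≠ j) : g.inner x (e i) (e j) = 0
  unit (i : Fin q) : g.inner x (e i) (e i) = 1 ∨ g.inner x (e i) (e i) = -1
  span_eq : Submodule.span ℝ (Set.range e) = D.fiber x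

/-- The mean curvature vector of `D` at `x`, computed with sections `e₁, …, e_q` of `D` which form
a pseudo-orthonormal basis of `D_x`. -/
def meanCurvatureVector (hD : D.IsNondegenerate g) {q : ℕ}
    (e : Fin q → Π x : M, TangentSpace 𝓘(ℝ, E) x) (x : M) : TangentSpace 𝓘(ℝ, E) x :=
  (1 / (q : ℝ)) • ∑ i, g.inner x (e i x) (e i x) • secondFundamentalForm hD (e i) (e i) x

/-- A nondegenerate distribution is minimal if its mean curvature vector vanishes identically.
As the second fundamental form is tensorial on sections of `D`, it does not matter by which
sections of `D` a pseudo-orthonormal basis of `D_x` is extended. -/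
def IsMinimal (hD : D.IsNondegenerate g) : Prop :=
  ∀ (x : M) (U : Set M), IsOpen U → x ∈ U →
    ∀ (q : ℕ) (e : Fin q → Π x : M, TangentSpace 𝓘(ℝ, E) x),
      (∀ i, D.IsSectionOn U (e i)) → D.IsPseudoOrthonormalBasis g x (fun i ↦ e i x) →
        meanCurvatureVector hD e x = 0

/-- Sections as in the definition of the mean curvature vector exist around every point. -/
theorem IsNondegenerate.exists_pseudoOrthonormal (hD : D.IsNondegenerate g) (x : M) :
    ∃ U : Set M, IsOpen U ∧ x ∈ U ∧
      ∃ (q : ℕ) (e : Fin q → Π x : M, TangentSpace 𝓘(ℝ, E) x),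
        (∀ i, D.IsSectionOn U (e i)) ∧ D.IsPseudoOrthonormalBasis g x (fun i ↦ e i x) := by
  obtain ⟨U, hU, hx, k, X, hX, hfr⟩ := D.exists_frame x
  refine ⟨U, hU, hx, finrank ℝ (D.fiber x), ?_⟩
  let B := (g.bilin x).restrict (D.fiber x)
  have : Invertible (2 : ℝ) := invertibleOfNonzero two_ne_zero
  have hBs : LinearMap.IsSymm B := ⟨fun v w ↦ g.symm x v w⟩
  obtain ⟨v, hv⟩ := LinearMap.BilinForm.exists_orthogonal_basis (B := B) hBs
  have hne (i) : B (v i) (v i) ≠ 0 := fun h ↦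
    hv.not_isOrtho_basis_self_of_separatingLeft (hD.restrict_nondegenerate x).1 i h
  let r (i) : ℝ := (Real.sqrt |B (v i) (v i)|)⁻¹
  have hr (i) : r i ≠ 0 := inv_ne_zero (Real.sqrt_ne_zero'.2 (abs_pos.2 (hne i)))
  have hr2 (i) : r i * r i * |B (v i) (v i)| = 1 := by
    have := Real.mul_self_sqrt (abs_nonneg (B (v i) (v i)))
    have h0 : |B (v i) (v i)| ≠ 0 := abs_ne_zero.2 (hne i)
    simp only [r]
    rw [← mul_inv, this, inv_mul_cancel₀ h0]
  have hmem (i) : ∃ c : Fin k → ℝ, ∑ j, c j • X j x = r i • (v i : TangentSpace 𝓘(ℝ, E) x) := by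
    have h : r i • (v i : TangentSpace 𝓘(ℝ, E) x) ∈ D.fiber x := (D.fiber x).smul_mem _ (v i).2
    exact (Submodule.mem_span_range_iff_exists_fun ℝ).1 ((hfr x hx).2.le h)
  choose c hc using hmem
  refine ⟨fun i y ↦ ∑ j, c i j • X j y, fun i ↦ ⟨?_, fun y hy ↦ ?_⟩, ?_, ?_, ?_⟩
  · have := ContMDiffOn.sum_section (I := 𝓘(ℝ, E)) (F := E) (V := (TangentSpace 𝓘(ℝ, E) : M → Type _))
      (s := Finset.univ) (t := fun j y ↦ c i j • X j y)
      (fun j _ ↦ (contMDiffOn_const (c := c i j)).smul_section (hX j))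
    exact this
  · rw [(hfr y hy).2]
    exact Submodule.sum_mem _ fun j _ ↦ Submodule.smul_mem _ _ (Submodule.subset_span ⟨j, rfl⟩)
  · intro i j hij
    have h : g.inner x (v i) (v j) = 0 := hv hij
    simp only [hc]
    simp [h]
  · intro i
    simp only [hc]
    have h := hr2 i
    have h' : g.inner x (r i • (v i : TangentSpace 𝓘(ℝ, E) x)) (r i • (v i)) =
        r i * r i * B (v i) (v i) := by
      simp [B]
      ring
    rw [h']
    rcases abs_choice (B (v i) (v i)) with h1 | h1
    · left; rw [← h1]; exact h
    · right; rw [h1] at h; linarith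
  · simp only [hc]
    have h1 : Submodule.span ℝ (Set.range fun i ↦ r i • (v i : TangentSpace 𝓘(ℝ, E) x)) =
        Submodule.span ℝ (Set.range fun i ↦ (v i : TangentSpace 𝓘(ℝ, E) x)) := by
      apply le_antisymm <;> rw [Submodule.span_le] <;> rintro _ ⟨i, rfl⟩
      · exact Submodule.smul_mem _ _ (Submodule.subset_span ⟨i, rfl⟩)
      · have : (v i : TangentSpace 𝓘(ℝ, E) x) = (r i)⁻¹ • r i • (v i : TangentSpace 𝓘(ℝ, E) x) := by
          rw [smul_smul, inv_mul_cancel₀ (hr i), one_smul]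
        simp only [SetLike.mem_coe]
        rw [this]
        exact Submodule.smul_mem _ _ (Submodule.subset_span ⟨i, rfl⟩)
    rw [h1]
    have h2 := congrArg (Submodule.map (D.fiber x).subtype) v.span_eq
    rw [Submodule.map_span, ← Set.range_comp, Submodule.map_top, Submodule.range_subtype] at h2
    exact h2

end TangentDistribution

/-! ### Paraquaternionic structures -/

/-- The signs `ε₁ = 1`, `ε₂ = ε₃ = -1`. -/
def paraSign : Fin 3 → ℝ := ![1, -1, -1]

/-- `J₁, J₂, J₃` is a canonical local basis, over the set `U`, of the family `σ` of subspaces of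
the endomorphism bundle of the tangent bundle. -/
structure IsCanonicalLocalBasis
    (σ : Π x : M, Submodule ℝ (TangentSpace 𝓘(ℝ, E) x →L[ℝ] TangentSpace 𝓘(ℝ, E) x))
    (U : Set M) (J : Fin 3 → Π x : M, TangentSpace 𝓘(ℝ, E) x →L[ℝ] TangentSpace 𝓘(ℝ, E) x) :
    Prop where
  contMDiffOn (α : Fin 3) : ContMDiffOn 𝓘(ℝ, E) (𝓘(ℝ, E).prod 𝓘(ℝ, E →L[ℝ] E)) ∞
    (fun x ↦ TotalSpace.mk' (E →L[ℝ] E)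
      (E := fun x : M ↦ TangentSpace 𝓘(ℝ, E) x →L[ℝ] TangentSpace 𝓘(ℝ, E) x) x (J α x)) U
  sq (x : M) (hx : x ∈ U) (α : Fin 3) (v : TangentSpace 𝓘(ℝ, E) x) :
    J α x (J α x v) = -paraSign α • v
  mul (x : M) (hx : x ∈ U) (α : Fin 3) (v : TangentSpace 𝓘(ℝ, E) x) :
    J α x (J (α + 1) x v) = paraSign (α + 2) • J (α + 2) x v
  anticomm (x : M) (hx : x ∈ U) (α : Fin 3) (v : TangentSpace 𝓘(ℝ, E) x) :
    J (α + 1) x (J α x v) = -J α x (J (α + 1) x v)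
  span_eq (x : M) (hx : x ∈ U) : σ x = Submodule.span ℝ (Set.range fun α ↦ J α x)

variable (E M) in
/-- An almost paraquaternionic structure: a rank 3 subbundle of the endomorphism bundle of the
tangent bundle which admits canonical local bases. -/
structure AlmostParaquaternionicStructure where
  fiber (x : M) : Submodule ℝ (TangentSpace 𝓘(ℝ, E) x →L[ℝ] TangentSpace 𝓘(ℝ, E) x)
  finrank_fiber (x : M) : finrank ℝ (fiber x) = 3
  exists_basis (x₀ : M) : ∃ U : Set M, IsOpen U ∧ x₀ ∈ U ∧ ∃ J, IsCanonicalLocalBasis fiber U J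

/-- The metric `g` is adapted to `σ`: `g(J_α X, J_α Y) = ε_α g(X, Y)` for all canonical local
bases of `σ`. -/
def IsAdapted (g : SemiRiemannianMetric E M) (σ : AlmostParaquaternionicStructure E M) : Prop :=
  ∀ (U : Set M) (J : Fin 3 → Π x : M, TangentSpace 𝓘(ℝ, E) x →L[ℝ] TangentSpace 𝓘(ℝ, E) x),
    IsOpen U → IsCanonicalLocalBasis σ.fiber U J → ∀ x ∈ U, ∀ (α : Fin 3)
      (v w : TangentSpace 𝓘(ℝ, E) x), g.inner x (J α x v) (J α x w) = paraSign α * g.inner x v w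

/-- The bundle `σ` is parallel with respect to the connection `∇`: if `S` is a smooth section of
`σ` over an open set, then the covariant derivative `T = ∇_v S`, the endomorphism given by
`(∇_v S) Y = ∇_v (S Y) - S (∇_v Y)`, lies again in `σ`. -/
def IsParallel (cov : CovariantDerivative 𝓘(ℝ, E) E (TangentSpace 𝓘(ℝ, E) : M → Type _))
    (σ : AlmostParaquaternionicStructure E M) : Prop :=
  ∀ (U : Set M) (S : Π x : M, TangentSpace 𝓘(ℝ, E) x →L[ℝ] TangentSpace 𝓘(ℝ, E) x),
    IsOpen U → (∀ x ∈ U, S x ∈ σ.fiber x) →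
    ContMDiffOn 𝓘(ℝ, E) (𝓘(ℝ, E).prod 𝓘(ℝ, E →L[ℝ] E)) ∞
      (fun x ↦ TotalSpace.mk' (E →L[ℝ] E)
        (E := fun x : M ↦ TangentSpace 𝓘(ℝ, E) x →L[ℝ] TangentSpace 𝓘(ℝ, E) x) x (S x)) U →
    ∀ x ∈ U, ∀ v : TangentSpace 𝓘(ℝ, E) x, ∃ T ∈ σ.fiber x,
      ∀ Y : Π x : M, TangentSpace 𝓘(ℝ, E) x, MDiffAt (T% Y) x →
        T (Y x) = cov (fun y ↦ S y (Y y)) x v - S x (cov Y x v)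

/-- `(M, σ, g)` is a paraquaternionic Kähler manifold: `g` is adapted to `σ`, and `σ` is parallel
with respect to the Levi-Civita connection of `g`. -/
structure IsParaquaternionicKahler [FiniteDimensional ℝ E] (g : SemiRiemannianMetric E M)
    (σ : AlmostParaquaternionicStructure E M) : Prop where
  adapted : IsAdapted g σ
  parallel : IsParallel g.leviCivita σ

end Metric

section Submanifold

variable {E : Type*} [NormedAddCommGroup E] [NormedSpace ℝ E]
  {M : Type*} [TopologicalSpace M] [ChartedSpace E M] [IsManifold 𝓘(ℝ, E) ∞ M]
  {F : Type*} [NormedAddCommGroup F] [NormedSpace ℝ F]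
  {N : Type*} [TopologicalSpace N] [ChartedSpace F N]

/-- `f : N → M` is an immersion onto a nondegenerate submanifold of `(M, g)`. -/
structure IsNondegenerateImmersion (g : SemiRiemannianMetric E M) (f : N → M) : Prop where
  isImmersion : Manifold.IsImmersion 𝓘(ℝ, F) 𝓘(ℝ, E) ∞ f
  nondegenerate (x : N) (v : TangentSpace 𝓘(ℝ, F) x)
    (hv : ∀ w : TangentSpace 𝓘(ℝ, F) x, g.inner (f x)
      (mfderiv 𝓘(ℝ, F) 𝓘(ℝ, E) f x v) (mfderiv 𝓘(ℝ, F) 𝓘(ℝ, E) f x w) = 0) : v = 0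

/-- The pullback of the bilinear form `g` at `f x` by the derivative of `f` at `x`. -/
def pullbackInner (g : SemiRiemannianMetric E M) (f : N → M) (x : N) :
    TangentSpace 𝓘(ℝ, F) x →L[ℝ] TangentSpace 𝓘(ℝ, F) x →L[ℝ] ℝ :=
  (ContinuousLinearMap.precomp ℝ (mfderiv 𝓘(ℝ, F) 𝓘(ℝ, E) f x)) ∘L g.inner (f x) ∘L
    mfderiv 𝓘(ℝ, F) 𝓘(ℝ, E) f x

@[simp]
theorem pullbackInner_apply (g : SemiRiemannianMetric E M) (f : N → M) (x : N)
    (v w : TangentSpace 𝓘(ℝ, F) x) :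
    pullbackInner g f x v w = g.inner (f x) (mfderiv 𝓘(ℝ, F) 𝓘(ℝ, E) f x v)
      (mfderiv 𝓘(ℝ, F) 𝓘(ℝ, E) f x w) :=
  rfl

variable [IsManifold 𝓘(ℝ, F) ∞ N]

theorem contMDiff_pullbackInner (g : SemiRiemannianMetric E M) {f : N → M}
    (hf : ContMDiff 𝓘(ℝ, F) 𝓘(ℝ, E) ∞ f) :
    ContMDiff 𝓘(ℝ, F) (𝓘(ℝ, F).prod 𝓘(ℝ, F →L[ℝ] F →L[ℝ] ℝ)) ∞
      (fun x ↦ TotalSpace.mk' (F →L[ℝ] F →L[ℝ] ℝ)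
        (E := fun x : N ↦ TangentSpace 𝓘(ℝ, F) x →L[ℝ] TangentSpace 𝓘(ℝ, F) x →L[ℝ] ℝ) x
        (pullbackInner g f x)) := by
  intro x₀
  rw [contMDiffAt_hom_bundle]
  refine ⟨contMDiffAt_id, ?_⟩
  have hA : ContMDiffAt 𝓘(ℝ, F) 𝓘(ℝ, F →L[ℝ] E) ∞ _ x₀ := (hf x₀).mfderiv_const (m := ∞) (by simp)
  have hG := ((contMDiffAt_hom_bundle _).1 (g.contMDiff (f x₀))).2.comp x₀ (hf x₀)
  have hB := (hA.clm_precomp (F₃ := ℝ)).clm_comp (hG.clm_comp hA)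
  refine hB.congr_of_eventuallyEq ?_
  have A : ∀ᶠ x in 𝓝 x₀, x ∈ (trivializationAt F (TangentSpace 𝓘(ℝ, F)) x₀).baseSet :=
    (trivializationAt F (TangentSpace 𝓘(ℝ, F)) x₀).open_baseSet.mem_nhds
      (FiberBundle.mem_baseSet_trivializationAt' x₀)
  have A' : ∀ᶠ x in 𝓝 x₀, f x ∈ (trivializationAt E (TangentSpace 𝓘(ℝ, E)) (f x₀)).baseSet :=
    (hf x₀).continuousAt ((trivializationAt E (TangentSpace 𝓘(ℝ, E)) (f x₀)).open_baseSet.mem_nhds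
      (FiberBundle.mem_baseSet_trivializationAt' (f x₀)))
  filter_upwards [A, A'] with x hx hfx
  ext u v
  rw [inCoordinates_apply_eq₂ (E₃ := fun _ ↦ ℝ) hx hx (Set.mem_univ _)]
  simp only [ContinuousLinearMap.comp_apply, ContinuousLinearMap.precomp_apply, Function.comp_apply]
  rw [inCoordinates_apply_eq₂ (E₃ := fun _ ↦ ℝ) hfx hfx (Set.mem_univ _)]
  simp only [inTangentCoordinates, id]
  rw [ContinuousLinearMap.inCoordinates_eq hx hfx]
  have key (w : TangentSpace 𝓘(ℝ, E) (f x)) :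
      (trivializationAt E (TangentSpace 𝓘(ℝ, E)) (f x₀)).symm (f x)
        (trivializationAt E (TangentSpace 𝓘(ℝ, E)) (f x₀) ⟨f x, w⟩).2 = w :=
    Trivialization.symm_apply_apply_mk _ hfx w
  simp
  rw [key, key]

/-- The metric induced on a nondegenerate immersed submanifold. -/
def inducedMetric (g : SemiRiemannianMetric E M) {f : N → M}
    (hf : IsNondegenerateImmersion (F := F) g f) : SemiRiemannianMetric F N where
  inner x := pullbackInner g f x
  symm _ _ _ := g.symm _ _ _
  nondegenerate x v hv := hf.nondegenerate x v hv
  contMDiff := contMDiff_pullbackInner g hf.isImmersion.contMDiff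

/-- The immersed nondegenerate submanifold `f : N → M` of `(M, σ, g)` is a paraquaternionic
CR-submanifold with paraquaternionic distribution `D`. -/
structure IsParaquaternionicCRSubmanifold (g : SemiRiemannianMetric E M)
    (σ : AlmostParaquaternionicStructure E M) {f : N → M}
    (hf : IsNondegenerateImmersion (F := F) g f) (D : TangentDistribution F N) : Prop where
  nondegenerate : D.IsNondegenerate (inducedMetric g hf)
  paraquaternionic (U : Set M)
    (J : Fin 3 → Π x : M, TangentSpace 𝓘(ℝ, E) x →L[ℝ] TangentSpace 𝓘(ℝ, E) x)
    (hU : IsOpen U) (hJ : IsCanonicalLocalBasis σ.fiber U J) (x : N) (hx : f x ∈ U) (α : Fin 3) :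
    ((D.fiber x).map (mfderiv 𝓘(ℝ, F) 𝓘(ℝ, E) f x).toLinearMap).map (J α (f x)).toLinearMap =
      (D.fiber x).map (mfderiv 𝓘(ℝ, F) 𝓘(ℝ, E) f x).toLinearMap
  totallyReal (U : Set M)
    (J : Fin 3 → Π x : M, TangentSpace 𝓘(ℝ, E) x →L[ℝ] TangentSpace 𝓘(ℝ, E) x)
    (hU : IsOpen U) (hJ : IsCanonicalLocalBasis σ.fiber U J) (x : N) (hx : f x ∈ U) (α : Fin 3)
    (v : TangentSpace 𝓘(ℝ, F) x) (hv : v ∈ D.orthogonal (inducedMetric g hf) x)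
    (w : TangentSpace 𝓘(ℝ, F) x) :
    g.inner (f x) (J α (f x) (mfderiv 𝓘(ℝ, F) 𝓘(ℝ, E) f x v))
      (mfderiv 𝓘(ℝ, F) 𝓘(ℝ, E) f x w) = 0

end Submanifold

end

/-! Let X be a section of D, u in D^⊥ at a point, and Y = J_α X, again a section of D. Write ∇' for
the ambient connection. By the Gauss formula ∇ may be replaced by ∇' when pairing with u, and ε_α
g(∇'_X X, u) = g(J_α ∇'_X X, J_α u) = g(∇'_X Y, J_α u) = g(∇'_Y X, J_α u) = -g(J_α ∇'_Y X, u) =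
-g(∇'_Y Y, u). The second and last equalities hold because ∇'J_α takes values in σ: the error term
is an element of σ applied to X, so it lies in D and is orthogonal both to the normal vector J_α u
and to u. The third holds because [X, Y] is tangent to N.

Thus g(∇_X X, u) = -ε_α g(∇_Y Y, u) (`inner_leviCivita_eq_neg`). Going from X to J_1 X directly
changes the sign, while going through J_3 X, with J_1 = J_2 J_3, does not, as ε_2 = ε_3 = -1. Hence
g(∇_X X, u) equals its own negative. Each term of the mean curvature vector vanishes separately.

The rest is transfer between N and M: fields along the immersion are extended to M, where J_α and ∇'
act, and the Lie brackets and Koszul expressions of related fields are compared. -/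

/-! ### Naturality of the Lie bracket under a smooth map. -/

/-- Differentiating the two relations produces second derivatives of `f`, which cancel in the
bracket by symmetry. `f` need not be invertible, so pullback of fields is not available here. -/
theorem fderiv_lieBracket_of_related {E F : Type*} [NormedAddCommGroup E] [NormedSpace ℝ E]
    [NormedAddCommGroup F] [NormedSpace ℝ F] {f : F → E} {V W : F → F} {V' W' : E → E} {u : F}
    (hf : ContDiffAt ℝ 2 f u) (hV : DifferentiableAt ℝ V u) (hW : DifferentiableAt ℝ W u)
    (hV' : DifferentiableAt ℝ V' (f u)) (hW' : DifferentiableAt ℝ W' (f u))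
    (hVV' : ∀ᶠ y in 𝓝 u, fderiv ℝ f y (V y) = V' (f y))
    (hWW' : ∀ᶠ y in 𝓝 u, fderiv ℝ f y (W y) = W' (f y)) :
    fderiv ℝ f u (lieBracket ℝ V W u) = lieBracket ℝ V' W' (f u) := by
  have hfu : DifferentiableAt ℝ f u := hf.differentiableAt two_ne_zero
  have hdf : DifferentiableAt ℝ (fderiv ℝ f) u :=
    (hf.fderiv_right (m := 1) (by norm_num)).differentiableAt one_ne_zero
  -- The relation Df·X = X' ∘ f differentiated in the direction `v`: product rule on one side, chain
  -- rule on the other.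
  have key {X : F → F} {X' : E → E} (hX : DifferentiableAt ℝ X u)
      (hX' : DifferentiableAt ℝ X' (f u)) (h : ∀ᶠ y in 𝓝 u, fderiv ℝ f y (X y) = X' (f y))
      (v : F) : fderiv ℝ X' (f u) (fderiv ℝ f u v) =
        fderiv ℝ (fderiv ℝ f) u v (X u) + fderiv ℝ f u (fderiv ℝ X u v) := by
    have h1 := Filter.EventuallyEq.fderiv_eq (𝕜 := ℝ) h
    rw [fderiv_clm_apply hdf hX, fderiv_fun_comp u hX' hfu] at h1
    have := congrArg (fun L ↦ L v) h1
    simpa [add_comm] using this.symm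
  have hs : fderiv ℝ (fderiv ℝ f) u (V u) (W u) = fderiv ℝ (fderiv ℝ f) u (W u) (V u) :=
    (hf.isSymmSndFDerivAt (by simp)).eq _ _
  rw [lieBracket_eq, lieBracket_eq]
  simp only [map_sub]
  rw [← hVV'.self_of_nhds, ← hWW'.self_of_nhds, key hV hV' hVV', key hW hW' hWW', hs]
  abel

section Related

variable {E : Type*} [NormedAddCommGroup E] [NormedSpace ℝ E] [CompleteSpace E]
  {M : Type*} [TopologicalSpace M] [ChartedSpace E M] [IsManifold 𝓘(ℝ, E) ∞ M]
  {F : Type*} [NormedAddCommGroup F] [NormedSpace ℝ F] [CompleteSpace F]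
  {N : Type*} [TopologicalSpace N] [ChartedSpace F N] [IsManifold 𝓘(ℝ, F) ∞ N]

variable (E) in
/-- The coordinate expression of a vector field in the preferred chart at `x`. -/
noncomputable def chartField (x : M) (V : Π x : M, TangentSpace 𝓘(ℝ, E) x) : E → E :=
  mpullbackWithin 𝓘(ℝ, E) 𝓘(ℝ, E) (extChartAt 𝓘(ℝ, E) x).symm V (Set.range 𝓘(ℝ, E))

omit [CompleteSpace E] in
theorem mfderiv_extChartAt_apply_eq {x y : M} (hy : y ∈ (extChartAt 𝓘(ℝ, E) x).source)
    (V : Π x : M, TangentSpace 𝓘(ℝ, E) x) :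
    mfderiv 𝓘(ℝ, E) 𝓘(ℝ, E) (extChartAt 𝓘(ℝ, E) x) y (V y) =
      chartField E x V (extChartAt 𝓘(ℝ, E) x y) := by
  have h' := PartialEquiv.map_source _ hy
  have hi := isInvertible_mfderivWithin_extChartAt_symm h'
  have e : chartField E x V (extChartAt 𝓘(ℝ, E) x y) =
    (mfderivWithin 𝓘(ℝ, E) 𝓘(ℝ, E) (extChartAt 𝓘(ℝ, E) x).symm (Set.range 𝓘(ℝ, E))
      (extChartAt 𝓘(ℝ, E) x y)).inverse (V ((extChartAt 𝓘(ℝ, E) x).symm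
        (extChartAt 𝓘(ℝ, E) x y))) := rfl
  rw [e, eq_comm, hi.inverse_apply_eq, PartialEquiv.left_inv _ hy]
  exact (congrArg (fun L ↦ L (V y))
    (mfderivWithin_extChartAt_symm_comp_mfderiv_extChartAt' (I := 𝓘(ℝ, E)) hy)).symm

-- The manifold bracket is by definition the bracket of coordinate expressions pulled back by the
-- chart. The model has no boundary, so the bracket within the range is the ordinary one.
omit [CompleteSpace E] in
theorem mfderiv_extChartAt_mlieBracket (x : M) (V W : Π x : M, TangentSpace 𝓘(ℝ, E) x) :
    mfderiv 𝓘(ℝ, E) 𝓘(ℝ, E) (extChartAt 𝓘(ℝ, E) x) x (mlieBracket 𝓘(ℝ, E) V W x) =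
      lieBracket ℝ (chartField E x V) (chartField E x W) (extChartAt 𝓘(ℝ, E) x x) := by
  have hi := isInvertible_mfderiv_extChartAt (I := 𝓘(ℝ, E))
    (mem_extChartAt_source (I := 𝓘(ℝ, E)) x)
  let b : E := lieBracketWithin ℝ (chartField E x V) (chartField E x W)
    ((extChartAt 𝓘(ℝ, E) x).symm ⁻¹' Set.univ ∩ Set.range 𝓘(ℝ, E)) (extChartAt 𝓘(ℝ, E) x x)
  have h : mlieBracket 𝓘(ℝ, E) V W x =
      (mfderiv 𝓘(ℝ, E) 𝓘(ℝ, E) (extChartAt 𝓘(ℝ, E) x) x).inverse b := rfl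
  have h' : b =
      lieBracket ℝ (chartField E x V) (chartField E x W) (extChartAt 𝓘(ℝ, E) x x) := by
    simp only [b]
    rw [Set.preimage_univ, ModelWithCorners.range_eq_univ, Set.univ_inter, lieBracketWithin_univ]
  rw [h, h']
  exact hi.self_apply_inverse _

theorem differentiableAt_chartField {x : M} {V : Π x : M, TangentSpace 𝓘(ℝ, E) x}
    (hV : MDiffAt (T% V) x) :
    DifferentiableAt ℝ (chartField E x V) (extChartAt 𝓘(ℝ, E) x x) := by
  have h : DifferentiableWithinAt ℝ (chartField E x V)
      ((extChartAt 𝓘(ℝ, E) x).symm ⁻¹' Set.univ ∩ Set.range 𝓘(ℝ, E)) (extChartAt 𝓘(ℝ, E) x x) :=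
    MDifferentiableWithinAt.differentiableWithinAt_mpullbackWithin_vectorField
      (mdifferentiableWithinAt_univ.2 hV)
  rwa [Set.preimage_univ, ModelWithCorners.range_eq_univ, Set.univ_inter,
    differentiableWithinAt_univ] at h

/-- The Lie bracket of vector fields is natural with respect to related vector fields. -/
theorem mfderiv_mlieBracket_of_related {f : N → M} {x : N}
    (hf : ContMDiff 𝓘(ℝ, F) 𝓘(ℝ, E) ∞ f)
    {V W : Π x : N, TangentSpace 𝓘(ℝ, F) x} {V' W' : Π x : M, TangentSpace 𝓘(ℝ, E) x}
    (hV : MDiffAt (T% V) x) (hW : MDiffAt (T% W) x)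
    (hV' : MDiffAt (T% V') (f x)) (hW' : MDiffAt (T% W') (f x))
    (hVV' : ∀ᶠ y in 𝓝 x, mfderiv 𝓘(ℝ, F) 𝓘(ℝ, E) f y (V y) = V' (f y))
    (hWW' : ∀ᶠ y in 𝓝 x, mfderiv 𝓘(ℝ, F) 𝓘(ℝ, E) f y (W y) = W' (f y)) :
    mfderiv 𝓘(ℝ, F) 𝓘(ℝ, E) f x (mlieBracket 𝓘(ℝ, F) V W x) =
      mlieBracket 𝓘(ℝ, E) V' W' (f x) := by
  have h2le : (2 : WithTop ℕ∞) ≤ ∞ := ENat.LEInfty.out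
  set φ := extChartAt 𝓘(ℝ, F) x with hφ
  set ψ := extChartAt 𝓘(ℝ, E) (f x) with hψ
  set G : F → E := ψ ∘ f ∘ φ.symm with hG
  have hfd : MDifferentiable 𝓘(ℝ, F) 𝓘(ℝ, E) f := hf.mdifferentiable (by simp)
  have hGx : G (φ x) = ψ (f x) := by simp [hG, hφ]
  have hG2 : ContDiffAt ℝ 2 G (φ x) := by
    rw [← contMDiffAt_iff_contDiffAt]
    have h1 : ContMDiffAt 𝓘(ℝ, F) 𝓘(ℝ, F) 2 φ.symm (φ x) :=
      (contMDiffOn_extChartAt_symm x).contMDiffAt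
        ((isOpen_extChartAt_target x).mem_nhds (mem_extChartAt_target x))
    have h2 : ContMDiffAt 𝓘(ℝ, E) 𝓘(ℝ, E) 2 ψ (f x) := contMDiffAt_extChartAt
    have hfx : ContMDiffAt 𝓘(ℝ, F) 𝓘(ℝ, E) 2 f x := (hf x).of_le h2le
    have e : φ.symm (φ x) = x := by simp [hφ]
    exact h2.comp_of_eq (hfx.comp_of_eq h1 e) (by simp [e])
  have hN : ∀ᶠ y in 𝓝 x, y ∈ φ.source ∧ f y ∈ ψ.source :=
    Filter.Eventually.and (extChartAt_source_mem_nhds x)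
      ((hf x).continuousAt (extChartAt_source_mem_nhds (f x)))
  -- Chain rule for G ∘ φ = ψ ∘ f. It is needed at all points near `x`, since relatedness in
  -- coordinates is a condition on a neighbourhood.
  have hGd {y : N} (hy : y ∈ φ.source) (hfy : f y ∈ ψ.source) (v : TangentSpace 𝓘(ℝ, F) y) :
      fderiv ℝ G (φ y) (mfderiv 𝓘(ℝ, F) 𝓘(ℝ, F) φ y v) =
        mfderiv 𝓘(ℝ, E) 𝓘(ℝ, E) ψ (f y) (mfderiv 𝓘(ℝ, F) 𝓘(ℝ, E) f y v) := by
    have e : φ.symm (φ y) = y := φ.left_inv hy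
    have hψd : MDifferentiableAt 𝓘(ℝ, E) 𝓘(ℝ, E) ψ (f y) :=
      mdifferentiableAt_extChartAt (by simpa [hψ] using hfy)
    have hφd : MDifferentiableAt 𝓘(ℝ, F) 𝓘(ℝ, F) φ y :=
      mdifferentiableAt_extChartAt (by simpa [hφ] using hy)
    have hφs : MDifferentiableAt 𝓘(ℝ, F) 𝓘(ℝ, F) φ.symm (φ y) :=
      (mdifferentiableOn_extChartAt_symm).mdifferentiableAt
        ((isOpen_extChartAt_target x).mem_nhds (φ.map_source hy))
    have hGm : MDifferentiableAt 𝓘(ℝ, F) 𝓘(ℝ, E) G (φ y) :=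
      
      MDifferentiableAt.comp_of_eq (φ y) hψd (MDifferentiableAt.comp_of_eq (φ y) (hfd y) hφs e)
        (by simp [e])
    have h1 : (G ∘ φ) =ᶠ[𝓝 y] ψ ∘ f := by
      filter_upwards [(isOpen_extChartAt_source x).mem_nhds hy] with z hz
      simp [hG, φ.left_inv hz]
    have h2 := h1.mfderiv_eq (I := 𝓘(ℝ, F)) (I' := 𝓘(ℝ, E))
    rw [mfderiv_comp y hGm hφd, mfderiv_comp y hψd (hfd y)] at h2
    have h3 := congrArg (fun L ↦ L v) h2
    rw [mfderiv_eq_fderiv] at h3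
    exact h3
  have hrel {X : Π x : N, TangentSpace 𝓘(ℝ, F) x} {X' : Π x : M, TangentSpace 𝓘(ℝ, E) x}
      (h : ∀ᶠ y in 𝓝 x, mfderiv 𝓘(ℝ, F) 𝓘(ℝ, E) f y (X y) = X' (f y)) :
      ∀ᶠ u in 𝓝 (φ x), fderiv ℝ G u (chartField F x X u) = chartField E (f x) X' (G u) := by
    have hc : ContinuousAt φ.symm (φ x) := continuousAt_extChartAt_symm x
    have e : φ.symm (φ x) = x := by simp [hφ]
    have h' := (hN.and h)
    rw [← e] at h'
    filter_upwards [hc.eventually h', (isOpen_extChartAt_target x).mem_nhds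
      (mem_extChartAt_target x)] with u ⟨⟨h1, h2⟩, h3⟩ hu
    have e' : φ (φ.symm u) = u := φ.right_inv hu
    have h4 := hGd h1 h2 (X (φ.symm u))
    rw [h3, mfderiv_extChartAt_apply_eq h2, mfderiv_extChartAt_apply_eq h1, ← hφ, ← hψ, e'] at h4
    exact h4
  have key := fderiv_lieBracket_of_related hG2 (differentiableAt_chartField hV)
    (differentiableAt_chartField hW) (hGx ▸ differentiableAt_chartField hV')
    (hGx ▸ differentiableAt_chartField hW') (hrel hVV') (hrel hWW')
  rw [hGx, hψ, ← mfderiv_extChartAt_mlieBracket, hφ, ← mfderiv_extChartAt_mlieBracket,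
    ← hφ, ← hψ, hGd (mem_extChartAt_source x) (mem_extChartAt_source (f x))] at key
  exact (isInvertible_mfderiv_extChartAt (mem_extChartAt_source (f x))).injective key

end Related

/-! ### Extending and lifting vector fields along an immersion. -/

section Immersion

variable {E : Type*} [NormedAddCommGroup E] [NormedSpace ℝ E]
  {M : Type*} [TopologicalSpace M] [ChartedSpace E M] [IsManifold 𝓘(ℝ, E) ∞ M]
  {F : Type*} [NormedAddCommGroup F] [NormedSpace ℝ F]
  {N : Type*} [TopologicalSpace N] [ChartedSpace F N] [IsManifold 𝓘(ℝ, F) ∞ N]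
  {f : N → M} {x : N}

omit [IsManifold 𝓘(ℝ, E) ∞ M] [IsManifold 𝓘(ℝ, F) ∞ N] in
/-- An immersion has a smooth local left inverse. -/
theorem Manifold.IsImmersionAt.exists_leftInverse
    (hf : Manifold.IsImmersionAt 𝓘(ℝ, F) 𝓘(ℝ, E) ∞ f x) :
    ∃ (V : Set M) (r : M → N), IsOpen V ∧ f x ∈ V ∧ ContMDiffOn 𝓘(ℝ, E) 𝓘(ℝ, F) ∞ r V ∧
      ∀ᶠ y in 𝓝 x, r (f y) = y := by
  -- In adapted charts `f` is the inclusion v ↦ (v, 0), and `L` is the projection that undoes it.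
  let L : E →L[ℝ] F := (ContinuousLinearMap.fst ℝ F hf.complement) ∘L
    (hf.equiv.symm : E →L[ℝ] F × hf.complement)
  have hw {y : N} (hy : y ∈ hf.domChart.source) : L (hf.codChart (f y)) = hf.domChart y := by
    have h := hf.writtenInCharts (show hf.domChart y ∈ (hf.domChart.extend 𝓘(ℝ, F)).target by
      simpa using hf.domChart.map_source hy)
    simp only [Function.comp_apply, OpenPartialHomeomorph.extend_coe,
      OpenPartialHomeomorph.extend_coe_symm, modelWithCornersSelf_coe, modelWithCornersSelf_coe_symm,
      id, hf.domChart.left_inv hy] at h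
    simp [L, h]
  refine ⟨hf.codChart.source ∩ hf.codChart ⁻¹' (L ⁻¹' hf.domChart.target),
    fun p ↦ hf.domChart.symm (L (hf.codChart p)),
    hf.codChart.isOpen_inter_preimage (hf.domChart.open_target.preimage L.continuous),
    ⟨hf.mem_codChart_source, ?_⟩, ?_, ?_⟩
  · simp only [Set.mem_preimage, hw hf.mem_domChart_source]
    exact hf.domChart.map_source hf.mem_domChart_source
  · have h1 := contMDiffOn_of_mem_maximalAtlas hf.codChart_mem_maximalAtlas
    have h2 := contMDiffOn_symm_of_mem_maximalAtlas hf.domChart_mem_maximalAtlas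
    exact h2.comp (L.contMDiff.comp_contMDiffOn (h1.mono Set.inter_subset_left)) fun p hp ↦ hp.2
  · filter_upwards [hf.domChart.open_source.mem_nhds hf.mem_domChart_source] with y hy
    rw [hw hy, hf.domChart.left_inv hy]

omit [IsManifold 𝓘(ℝ, F) ∞ N] in
/-- A vector field along an immersion extends locally to a vector field. -/
theorem Manifold.IsImmersionAt.exists_extension
    (hf : Manifold.IsImmersionAt 𝓘(ℝ, F) 𝓘(ℝ, E) ∞ f x)
    {W : Π y : N, TangentSpace 𝓘(ℝ, E) (f y)}
    (hW : MDifferentiableAt 𝓘(ℝ, F) 𝓘(ℝ, E).tangent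
      (fun y ↦ (⟨f y, W y⟩ : TangentBundle 𝓘(ℝ, E) M)) x) :
    ∃ W' : Π p : M, TangentSpace 𝓘(ℝ, E) p, MDiffAt (T% W') (f x) ∧
      ∀ᶠ y in 𝓝 x, W' (f y) = W y := by
  obtain ⟨V, r, hV, hx, hr, hrf⟩ := hf.exists_leftInverse
  set e := trivializationAt E (TangentSpace 𝓘(ℝ, E) : M → Type _) (f x) with he
  have hrx : r (f x) = x := hrf.self_of_nhds
  have hbase : e.baseSet ∈ 𝓝 (f x) := e.open_baseSet.mem_nhds
    (FiberBundle.mem_baseSet_trivializationAt' (f x))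
  -- W(r p) lies over f(r p) rather than over p; the trivialization at f(x) moves it to the fibre
  -- over p.
  refine ⟨fun p ↦ e.symm p (e ⟨f (r p), W (r p)⟩).2, ?_, ?_⟩
  · rw [mdifferentiableAt_section]
    have h1 : MDifferentiableAt 𝓘(ℝ, F) 𝓘(ℝ, E) (fun y ↦ (e ⟨f y, W y⟩).2) x :=
      ((mdifferentiableAt_totalSpace _ _).1 hW).2
    have h2 : MDifferentiableAt 𝓘(ℝ, E) 𝓘(ℝ, F) r (f x) :=
      ((hr.contMDiffAt (hV.mem_nhds hx)).mdifferentiableAt (by simp))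
    refine (MDifferentiableAt.comp_of_eq (f x) h1 h2 hrx).congr_of_eventuallyEq ?_
    filter_upwards [hbase] with p hp
    rw [e.apply_mk_symm hp]
    rfl
  · filter_upwards [hrf, hf.contMDiffAt.continuousAt hbase] with y hy hfy
    rw [hy]
    exact Trivialization.symm_apply_apply_mk _ hfy _

/-- The field along `f` is the tangent map of `f` composed with the section `X`. -/
theorem ContMDiff.mdifferentiableAt_mfderiv_apply (hf : ContMDiff 𝓘(ℝ, F) 𝓘(ℝ, E) ∞ f)
    {X : Π y : N, TangentSpace 𝓘(ℝ, F) y} (hX : MDiffAt (T% X) x) :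
    MDifferentiableAt 𝓘(ℝ, F) 𝓘(ℝ, E).tangent
      (fun y ↦ (⟨f y, mfderiv 𝓘(ℝ, F) 𝓘(ℝ, E) f y (X y)⟩ : TangentBundle 𝓘(ℝ, E) M)) x :=
  ((hf.contMDiff_tangentMap (m := 1) (by norm_num; exact ENat.LEInfty.out)).mdifferentiableAt one_ne_zero).comp x hX

/-- A vector field along an immersion which is tangent to it is locally the image of a
vector field. -/
theorem Manifold.IsImmersionAt.exists_lift
    (hf : Manifold.IsImmersionAt 𝓘(ℝ, F) 𝓘(ℝ, E) ∞ f x)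
    {W : Π y : N, TangentSpace 𝓘(ℝ, E) (f y)}
    (hW : MDifferentiableAt 𝓘(ℝ, F) 𝓘(ℝ, E).tangent
      (fun y ↦ (⟨f y, W y⟩ : TangentBundle 𝓘(ℝ, E) M)) x)
    (hWf : ∀ᶠ y in 𝓝 x, W y ∈ Set.range (mfderiv 𝓘(ℝ, F) 𝓘(ℝ, E) f y)) :
    ∃ Y : Π y : N, TangentSpace 𝓘(ℝ, F) y, MDiffAt (T% Y) x ∧
      ∀ᶠ y in 𝓝 x, mfderiv 𝓘(ℝ, F) 𝓘(ℝ, E) f y (Y y) = W y := by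
  obtain ⟨V, r, hV, hx, hr, hrf⟩ := hf.exists_leftInverse
  have hVx : ∀ᶠ y in 𝓝 x, f y ∈ V := hf.contMDiffAt.continuousAt (hV.mem_nhds hx)
  have hfd : ∀ᶠ y in 𝓝 x, MDifferentiableAt 𝓘(ℝ, F) 𝓘(ℝ, E) f y := by
    filter_upwards [hf.domChart.open_source.mem_nhds hf.mem_domChart_source] with y hy
    exact (hf.contMDiffOn.contMDiffAt (hf.domChart.open_source.mem_nhds hy)).mdifferentiableAt
      (by simp)
  have hmk {a b : N} (h : a = b) (v : F) :
      (⟨a, v⟩ : TangentBundle 𝓘(ℝ, F) N) = ⟨b, v⟩ := by subst h; rfl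
  -- The lift is dr(W), as dr ∘ df = id. It naturally lives over r(f y), equal to y only
  -- propositionally; both fibres are `F` by definition, which the ascription exploits.
  refine ⟨fun y ↦ (mfderiv 𝓘(ℝ, E) 𝓘(ℝ, F) r (f y) (W y) : F), ?_, ?_⟩
  · have h1 : ContMDiffOn 𝓘(ℝ, E).tangent 𝓘(ℝ, F).tangent 1
        (tangentMapWithin 𝓘(ℝ, E) 𝓘(ℝ, F) r V)
        (TotalSpace.proj (F := E) (E := (TangentSpace 𝓘(ℝ, E) : M → Type _)) ⁻¹' V) :=
      hr.contMDiffOn_tangentMapWithin (by norm_num; exact ENat.LEInfty.out) hV.uniqueMDiffOn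
    have h2 : (TotalSpace.proj (F := E) (E := (TangentSpace 𝓘(ℝ, E) : M → Type _)) ⁻¹' V) ∈
        𝓝 (⟨f x, W x⟩ : TangentBundle 𝓘(ℝ, E) M) :=
      (hV.preimage (FiberBundle.continuous_proj E (TangentSpace 𝓘(ℝ, E) : M → Type _))).mem_nhds hx
    have h3 := ((h1.contMDiffAt h2).mdifferentiableAt one_ne_zero).comp x hW
    refine h3.congr_of_eventuallyEq ?_
    filter_upwards [hrf, hVx] with y hy hyV
    simp only [Function.comp_apply, tangentMapWithin]
    rw [mfderivWithin_of_mem_nhds (hV.mem_nhds hyV)]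
    exact hmk hy.symm _
  · filter_upwards [hWf, hrf.eventually_nhds, hVx, hfd] with y ⟨u, hu⟩ hy hyV hfy
    have h1 : MDifferentiableAt 𝓘(ℝ, E) 𝓘(ℝ, F) r (f y) :=
      (hr.contMDiffAt (hV.mem_nhds hyV)).mdifferentiableAt (by simp)
    have h2 : (r ∘ f) =ᶠ[𝓝 y] id := hy
    have h3 := h2.mfderiv_eq (I := 𝓘(ℝ, F)) (I' := 𝓘(ℝ, F))
    rw [mfderiv_comp y h1 hfy, mfderiv_id] at h3
    have h4 : mfderiv 𝓘(ℝ, E) 𝓘(ℝ, F) r (f y) (mfderiv 𝓘(ℝ, F) 𝓘(ℝ, E) f y u) = u :=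
      congrArg (fun L ↦ L u) h3
    rw [← hu]
    exact congrArg (mfderiv 𝓘(ℝ, F) 𝓘(ℝ, E) f y) h4

end Immersion

/-! ### Koszul formula and Gauss formula. -/

namespace SemiRiemannianMetric

section Koszul

variable {E : Type*} [NormedAddCommGroup E] [NormedSpace ℝ E] [FiniteDimensional ℝ E]
  {M : Type*} [TopologicalSpace M] [ChartedSpace E M] [IsManifold 𝓘(ℝ, E) ∞ M]
  (g : SemiRiemannianMetric E M)

/-- The Koszul formula. -/
theorem two_mul_inner_leviCivita {x : M} {X Y Z : Π x : M, TangentSpace 𝓘(ℝ, E) x}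
    (hX : MDiffAt (T% X) x) (hY : MDiffAt (T% Y) x) (hZ : MDiffAt (T% Z) x) :
    2 * g.inner x (g.leviCivita Y x (X x)) (Z x) = g.koszul X Y Z x := by
  have h := g.isLeviCivita_leviCivita
  rw [koszul, h.metric _ hY hZ, h.metric _ hX hZ, h.metric _ hX hY, ← h.torsionFree hX hY,
    ← h.torsionFree hX hZ, ← h.torsionFree hY hZ]
  simp only [map_sub, sub_apply]
  rw [g.symm x (Y x), g.symm x (X x) (g.leviCivita Z x _), g.symm x (X x) (g.leviCivita Y x _)]
  ring

end Koszul

end SemiRiemannianMetric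

section Gauss

variable {E : Type*} [NormedAddCommGroup E] [NormedSpace ℝ E] [FiniteDimensional ℝ E]
  {M : Type*} [TopologicalSpace M] [ChartedSpace E M] [IsManifold 𝓘(ℝ, E) ∞ M]
  {F : Type*} [NormedAddCommGroup F] [NormedSpace ℝ F] [FiniteDimensional ℝ F]
  {N : Type*} [TopologicalSpace N] [ChartedSpace F N] [IsManifold 𝓘(ℝ, F) ∞ N]
  {g : SemiRiemannianMetric E M} {f : N → M} {x : N}

omit [FiniteDimensional ℝ E] [FiniteDimensional ℝ F] in
theorem inducedMetric_inner (hf : IsNondegenerateImmersion (F := F) g f) (x : N)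
    (v w : TangentSpace 𝓘(ℝ, F) x) :
    (inducedMetric g hf).inner x v w = g.inner (f x) (mfderiv 𝓘(ℝ, F) 𝓘(ℝ, E) f x v)
      (mfderiv 𝓘(ℝ, F) 𝓘(ℝ, E) f x w) :=
  rfl

/-- Every term is natural: inner products of related fields correspond under composition with `f`,
and so do brackets. With the Koszul formula this gives the Gauss formula. -/
theorem koszul_inducedMetric (hf : IsNondegenerateImmersion (F := F) g f)
    {X Y Z : Π x : N, TangentSpace 𝓘(ℝ, F) x} {X' Y' Z' : Π x : M, TangentSpace 𝓘(ℝ, E) x}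
    (hX : MDiffAt (T% X) x) (hY : MDiffAt (T% Y) x) (hZ : MDiffAt (T% Z) x)
    (hX' : MDiffAt (T% X') (f x)) (hY' : MDiffAt (T% Y') (f x)) (hZ' : MDiffAt (T% Z') (f x))
    (hXX' : ∀ᶠ y in 𝓝 x, mfderiv 𝓘(ℝ, F) 𝓘(ℝ, E) f y (X y) = X' (f y))
    (hYY' : ∀ᶠ y in 𝓝 x, mfderiv 𝓘(ℝ, F) 𝓘(ℝ, E) f y (Y y) = Y' (f y))
    (hZZ' : ∀ᶠ y in 𝓝 x, mfderiv 𝓘(ℝ, F) 𝓘(ℝ, E) f y (Z y) = Z' (f y)) :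
    (inducedMetric g hf).koszul X Y Z x = g.koszul X' Y' Z' (f x) := by
  have : CompleteSpace E := FiniteDimensional.complete ℝ E
  have : CompleteSpace F := FiniteDimensional.complete ℝ F
  have hfs := hf.isImmersion.contMDiff
  have hfd : MDifferentiableAt 𝓘(ℝ, F) 𝓘(ℝ, E) f x := hfs.mdifferentiable (by simp) x
  have hd {A B C : Π x : N, TangentSpace 𝓘(ℝ, F) x} {A' B' C' : Π x : M, TangentSpace 𝓘(ℝ, E) x}
      (hA' : MDiffAt (T% A') (f x)) (hB' : MDiffAt (T% B') (f x))
      (hA : ∀ᶠ y in 𝓝 x, mfderiv 𝓘(ℝ, F) 𝓘(ℝ, E) f y (A y) = A' (f y))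
      (hB : ∀ᶠ y in 𝓝 x, mfderiv 𝓘(ℝ, F) 𝓘(ℝ, E) f y (B y) = B' (f y))
      (hC : ∀ᶠ y in 𝓝 x, mfderiv 𝓘(ℝ, F) 𝓘(ℝ, E) f y (C y) = C' (f y)) :
      d% (fun y ↦ (inducedMetric g hf).inner y (A y) (B y)) x (C x) =
        d% (fun p ↦ g.inner p (A' p) (B' p)) (f x) (C' (f x)) := by
    have h1 : (fun y ↦ (inducedMetric g hf).inner y (A y) (B y)) =ᶠ[𝓝 x]
        (fun p ↦ g.inner p (A' p) (B' p)) ∘ f := by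
      filter_upwards [hA, hB] with y h1 h2
      rw [inducedMetric_inner, h1, h2]
      rfl
    rw [← hC.self_of_nhds, ← mvfderiv_comp_apply x (g.mdifferentiableAt_inner hA' hB') hfd]
    exact congrArg (fun L ↦ L (C x)) (h1.mfderiv_eq (I := 𝓘(ℝ, F)) (I' := 𝓘(ℝ, ℝ)))
  simp only [SemiRiemannianMetric.koszul]
  rw [hd hY' hZ' hYY' hZZ' hXX', hd hX' hZ' hXX' hZZ' hYY', hd hX' hY' hXX' hYY' hZZ']
  simp only [inducedMetric_inner]
  rw [mfderiv_mlieBracket_of_related hfs hX hY hX' hY' hXX' hYY',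
    mfderiv_mlieBracket_of_related hfs hX hZ hX' hZ' hXX' hZZ',
    mfderiv_mlieBracket_of_related hfs hY hZ hY' hZ' hYY' hZZ',
    hXX'.self_of_nhds, hYY'.self_of_nhds, hZZ'.self_of_nhds]

/-- The Gauss formula: the Levi-Civita connection of a submanifold is the tangential part of the
ambient Levi-Civita connection. -/
theorem inner_leviCivita_inducedMetric (hf : IsNondegenerateImmersion (F := F) g f)
    {X Y : Π x : N, TangentSpace 𝓘(ℝ, F) x} {X' Y' : Π x : M, TangentSpace 𝓘(ℝ, E) x}
    (hX : MDiffAt (T% X) x) (hY : MDiffAt (T% Y) x)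
    (hX' : MDiffAt (T% X') (f x)) (hY' : MDiffAt (T% Y') (f x))
    (hXX' : ∀ᶠ y in 𝓝 x, mfderiv 𝓘(ℝ, F) 𝓘(ℝ, E) f y (X y) = X' (f y))
    (hYY' : ∀ᶠ y in 𝓝 x, mfderiv 𝓘(ℝ, F) 𝓘(ℝ, E) f y (Y y) = Y' (f y))
    (u : TangentSpace 𝓘(ℝ, F) x) :
    (inducedMetric g hf).inner x ((inducedMetric g hf).leviCivita Y x (X x)) u =
      g.inner (f x) (g.leviCivita Y' (f x) (X' (f x))) (mfderiv 𝓘(ℝ, F) 𝓘(ℝ, E) f x u) := by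
  have hZ := FiberBundle.mdifferentiableAt_extend (I := 𝓘(ℝ, F)) (F := F) u
  obtain ⟨Z', hZ', hZZ'⟩ := (hf.isImmersion.isImmersionAt x).exists_extension
    (hf.isImmersion.contMDiff.mdifferentiableAt_mfderiv_apply hZ)
  have hZZ'' := hZZ'.mono fun y hy ↦ hy.symm
  have h := koszul_inducedMetric hf hX hY hZ hX' hY' hZ' hXX' hYY' hZZ''
  rw [← SemiRiemannianMetric.two_mul_inner_leviCivita _ hX hY hZ,
    ← SemiRiemannianMetric.two_mul_inner_leviCivita _ hX' hY' hZ', ← hZZ''.self_of_nhds,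
    FiberBundle.extend_apply_self] at h
  linarith

end Gauss

/-! ### Paraquaternionic CR-submanifolds. -/

section CR

variable {E : Type*} [NormedAddCommGroup E] [NormedSpace ℝ E] [FiniteDimensional ℝ E]
  {M : Type*} [TopologicalSpace M] [ChartedSpace E M] [IsManifold 𝓘(ℝ, E) ∞ M]
  {F : Type*} [NormedAddCommGroup F] [NormedSpace ℝ F] [FiniteDimensional ℝ F]
  {N : Type*} [TopologicalSpace N] [ChartedSpace F N] [IsManifold 𝓘(ℝ, F) ∞ N]
  {g : SemiRiemannianMetric E M} {σ : AlmostParaquaternionicStructure E M}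
  {f : N → M} {hf : IsNondegenerateImmersion (F := F) g f} {D : TangentDistribution F N}
  {U : Set M} {J : Fin 3 → Π x : M, TangentSpace 𝓘(ℝ, E) x →L[ℝ] TangentSpace 𝓘(ℝ, E) x}
  {x : N}

theorem paraSign_mul_self (α : Fin 3) : paraSign α * paraSign α = 1 := by
  fin_cases α <;> simp [paraSign]

-- Each J_α is skew-adjoint: apply compatibility to v and J_α w, and use J_α² = -ε_α.
omit [FiniteDimensional ℝ E] in
theorem IsAdapted.inner_apply_right (hg : IsAdapted g σ) (hU : IsOpen U)
    (hJ : IsCanonicalLocalBasis σ.fiber U J) {p : M} (hp : p ∈ U) (α : Fin 3)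
    (v w : TangentSpace 𝓘(ℝ, E) p) :
    g.inner p v (J α p w) = -g.inner p (J α p v) w := by
  have h := hg U J hU hJ p hp α v (J α p w)
  rw [hJ.sq p hp, map_smul, smul_eq_mul] at h
  have h1 := paraSign_mul_self α
  linear_combination (-paraSign α) * h + (-g.inner p v (J α p w) - g.inner p (J α p v) w) * h1

omit [FiniteDimensional ℝ E] [FiniteDimensional ℝ F] in
theorem IsParaquaternionicCRSubmanifold.exists_mfderiv_eq
    (hD : IsParaquaternionicCRSubmanifold g σ hf D) (hU : IsOpen U)
    (hJ : IsCanonicalLocalBasis σ.fiber U J) (hx : f x ∈ U) (α : Fin 3)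
    {v : TangentSpace 𝓘(ℝ, F) x} (hv : v ∈ D.fiber x) :
    ∃ w ∈ D.fiber x, mfderiv 𝓘(ℝ, F) 𝓘(ℝ, E) f x w =
      J α (f x) (mfderiv 𝓘(ℝ, F) 𝓘(ℝ, E) f x v) := by
  have h : J α (f x) (mfderiv 𝓘(ℝ, F) 𝓘(ℝ, E) f x v) ∈
      (D.fiber x).map (mfderiv 𝓘(ℝ, F) 𝓘(ℝ, E) f x).toLinearMap := by
    rw [← hD.paraquaternionic U J hU hJ x hx α]
    exact Submodule.mem_map_of_mem (Submodule.mem_map_of_mem hv)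
  exact h

omit [FiniteDimensional ℝ E] [FiniteDimensional ℝ F] in
/-- The paraquaternionic distribution is invariant under all elements of `σ`. -/
theorem IsParaquaternionicCRSubmanifold.exists_mfderiv_eq_of_mem
    (hD : IsParaquaternionicCRSubmanifold g σ hf D)
    {T : TangentSpace 𝓘(ℝ, E) (f x) →L[ℝ] TangentSpace 𝓘(ℝ, E) (f x)} (hT : T ∈ σ.fiber (f x))
    {v : TangentSpace 𝓘(ℝ, F) x} (hv : v ∈ D.fiber x) :
    ∃ w ∈ D.fiber x, mfderiv 𝓘(ℝ, F) 𝓘(ℝ, E) f x w =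
      T (mfderiv 𝓘(ℝ, F) 𝓘(ℝ, E) f x v) := by
  obtain ⟨U, hU, hx, J, hJ⟩ := σ.exists_basis (f x)
  rw [hJ.span_eq _ hx] at hT
  induction hT using Submodule.span_induction with
  | mem T hT =>
    obtain ⟨α, rfl⟩ := hT
    exact hD.exists_mfderiv_eq hU hJ hx α hv
  | zero => exact ⟨0, Submodule.zero_mem _, by simp⟩
  | add T T' _ _ h h' =>
    obtain ⟨w, hw, e⟩ := h
    obtain ⟨w', hw', e'⟩ := h'
    exact ⟨w + w', Submodule.add_mem _ hw hw', by simp [e, e']⟩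
  | smul c T _ h =>
    obtain ⟨w, hw, e⟩ := h
    exact ⟨c • w, Submodule.smul_mem _ _ hw, by simp [e]⟩

omit [FiniteDimensional ℝ E] in
theorem IsCanonicalLocalBasis.mdifferentiableAt (hU : IsOpen U)
    (hJ : IsCanonicalLocalBasis σ.fiber U J) {p : M} (hp : p ∈ U) (α : Fin 3) :
    MDifferentiableAt 𝓘(ℝ, E) (𝓘(ℝ, E).prod 𝓘(ℝ, E →L[ℝ] E))
      (fun x ↦ TotalSpace.mk' (E →L[ℝ] E)
        (E := fun x : M ↦ TangentSpace 𝓘(ℝ, E) x →L[ℝ] TangentSpace 𝓘(ℝ, E) x) x (J α x)) p :=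
  ((hJ.contMDiffOn α).contMDiffAt (hU.mem_nhds hp)).mdifferentiableAt (by simp)

/-- For fields `X` and `Y = J_α X` of the paraquaternionic distribution, the components of
`∇_X X` and `-ε_α ∇_Y Y` orthogonal to the distribution agree. -/
theorem IsParaquaternionicCRSubmanifold.inner_leviCivita_eq_neg
    (hM : IsParaquaternionicKahler g σ) (hD : IsParaquaternionicCRSubmanifold g σ hf D)
    (hU : IsOpen U) (hJ : IsCanonicalLocalBasis σ.fiber U J) (hx : f x ∈ U) (α : Fin 3)
    {X Y : Π x : N, TangentSpace 𝓘(ℝ, F) x} (hX : MDiffAt (T% X) x) (hY : MDiffAt (T% Y) x)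
    (hXD : X x ∈ D.fiber x)
    (hXY : ∀ᶠ y in 𝓝 x, mfderiv 𝓘(ℝ, F) 𝓘(ℝ, E) f y (Y y) =
      J α (f y) (mfderiv 𝓘(ℝ, F) 𝓘(ℝ, E) f y (X y)))
    {u : TangentSpace 𝓘(ℝ, F) x} (hu : u ∈ D.orthogonal (inducedMetric g hf) x) :
    (inducedMetric g hf).inner x ((inducedMetric g hf).leviCivita X x (X x)) u =
      -paraSign α *
        (inducedMetric g hf).inner x ((inducedMetric g hf).leviCivita Y x (Y x)) u := by
  have : CompleteSpace E := FiniteDimensional.complete ℝ E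
  have : CompleteSpace F := FiniteDimensional.complete ℝ F
  have hfs := hf.isImmersion.contMDiff
  obtain ⟨X', hX', h⟩ := (hf.isImmersion.isImmersionAt x).exists_extension
    (hfs.mdifferentiableAt_mfderiv_apply hX)
  have hXX' := h.mono fun y hy ↦ hy.symm
  -- Extending Y by J_α X', not arbitrarily, lets parallelism compare ∇'Y' with J_α ∇'X'.
  set Y' : Π p : M, TangentSpace 𝓘(ℝ, E) p := fun p ↦ J α p (X' p) with hY'def
  have hY' : MDiffAt (T% Y') (f x) :=
    (hJ.mdifferentiableAt hU hx α).clm_bundle_apply hX'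
  have hYY' : ∀ᶠ y in 𝓝 x, mfderiv 𝓘(ℝ, F) 𝓘(ℝ, E) f y (Y y) = Y' (f y) := by
    filter_upwards [hXY, hXX'] with y h1 h2
    rw [h1, h2]
  rw [inner_leviCivita_inducedMetric hf hX hX hX' hX' hXX' hXX',
    inner_leviCivita_inducedMetric hf hY hY hY' hY' hYY' hYY']
  have hJσ : ∀ p ∈ U, J α p ∈ σ.fiber p := fun p hp ↦ by
    rw [hJ.span_eq p hp]
    exact Submodule.subset_span ⟨α, rfl⟩
  have hpar := hM.parallel U (J α) hU hJσ (hJ.contMDiffOn α) (f x) hx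
  -- T = ∇'_X J_α and S = ∇'_Y J_α; both lie in σ, hence map X into D.
  obtain ⟨T, hT, hTeq⟩ := hpar (X' (f x))
  obtain ⟨S, hS, hSeq⟩ := hpar (Y' (f x))
  have hTX := hTeq X' hX'
  have hSX := hSeq X' hX'
  rw [← hXX'.self_of_nhds] at hTX hSX
  obtain ⟨t, ht, hte⟩ := hD.exists_mfderiv_eq_of_mem hT hXD
  obtain ⟨s, hs, hse⟩ := hD.exists_mfderiv_eq_of_mem hS hXD
  rw [← hte, hXX'.self_of_nhds] at hTX
  rw [← hse] at hSX
  set du := mfderiv 𝓘(ℝ, F) 𝓘(ℝ, E) f x u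
  have hn (w : TangentSpace 𝓘(ℝ, F) x) :
      g.inner (f x) (mfderiv 𝓘(ℝ, F) 𝓘(ℝ, E) f x w) (J α (f x) du) = 0 := by
    rw [g.symm]
    exact hD.totallyReal U J hU hJ x hx α u hu w
  have h1 : g.inner (f x) (J α (f x) (g.leviCivita X' (f x) (X' (f x)))) (J α (f x) du) =
      g.inner (f x) (g.leviCivita Y' (f x) (X' (f x))) (J α (f x) du) := by
    have := hn t
    rw [hTX, map_sub, sub_apply] at this
    linarith
  have h2 : g.inner (f x) (g.leviCivita Y' (f x) (X' (f x))) (J α (f x) du) =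
      g.inner (f x) (g.leviCivita X' (f x) (Y' (f x))) (J α (f x) du) := by
    have := hn (mlieBracket 𝓘(ℝ, F) X Y x)
    rw [mfderiv_mlieBracket_of_related hfs hX hY hX' hY' hXX' hYY',
      ← g.isLeviCivita_leviCivita.torsionFree hX' hY', map_sub, sub_apply] at this
    linarith
  have h3 : g.inner (f x) (J α (f x) (g.leviCivita X' (f x) (Y' (f x)))) du =
      g.inner (f x) (g.leviCivita Y' (f x) (Y' (f x))) du := by
    have : g.inner (f x) (mfderiv 𝓘(ℝ, F) 𝓘(ℝ, E) f x s) du = 0 := hu s hs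
    rw [hSX, map_sub, sub_apply] at this
    linarith
  have h4 := hM.adapted U J hU hJ (f x) hx α (g.leviCivita X' (f x) (X' (f x))) du
  rw [h1, h2, hM.adapted.inner_apply_right hU hJ hx, h3] at h4
  have h5 := paraSign_mul_self α
  linear_combination (-paraSign α) * h4 -
    g.inner (f x) (g.leviCivita X' (f x) (X' (f x))) du * h5

omit [FiniteDimensional ℝ E] [FiniteDimensional ℝ F] in
/-- If `X` is a field of the paraquaternionic distribution, then so is `J_α X`. -/
theorem IsParaquaternionicCRSubmanifold.exists_field
    (hD : IsParaquaternionicCRSubmanifold g σ hf D) (hU : IsOpen U)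
    (hJ : IsCanonicalLocalBasis σ.fiber U J) (hx : f x ∈ U) (α : Fin 3)
    {X : Π x : N, TangentSpace 𝓘(ℝ, F) x} (hX : MDiffAt (T% X) x)
    (hXD : ∀ᶠ y in 𝓝 x, X y ∈ D.fiber y) :
    ∃ Y : Π x : N, TangentSpace 𝓘(ℝ, F) x, MDiffAt (T% Y) x ∧
      (∀ᶠ y in 𝓝 x, Y y ∈ D.fiber y) ∧
      ∀ᶠ y in 𝓝 x, mfderiv 𝓘(ℝ, F) 𝓘(ℝ, E) f y (Y y) =
        J α (f y) (mfderiv 𝓘(ℝ, F) 𝓘(ℝ, E) f y (X y)) := by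
  have hfs := hf.isImmersion.contMDiff
  have hUx : ∀ᶠ y in 𝓝 x, f y ∈ U := hfs.continuous.continuousAt (hU.mem_nhds hx)
  have hex : ∀ᶠ y in 𝓝 x, ∃ w ∈ D.fiber y, mfderiv 𝓘(ℝ, F) 𝓘(ℝ, E) f y w =
      J α (f y) (mfderiv 𝓘(ℝ, F) 𝓘(ℝ, E) f y (X y)) := by
    filter_upwards [hUx, hXD] with y hy hXy using hD.exists_mfderiv_eq hU hJ hy α hXy
  have hW : MDifferentiableAt 𝓘(ℝ, F) 𝓘(ℝ, E).tangent (fun y ↦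
      (⟨f y, J α (f y) (mfderiv 𝓘(ℝ, F) 𝓘(ℝ, E) f y (X y))⟩ : TangentBundle 𝓘(ℝ, E) M)) x :=
    MDifferentiableAt.clm_bundle_apply (F₁ := E) (F₂ := E)
      (E₁ := (TangentSpace 𝓘(ℝ, E) : M → Type _)) (E₂ := (TangentSpace 𝓘(ℝ, E) : M → Type _))
      (b := f) (ϕ := fun y ↦ J α (f y)) (v := fun y ↦ mfderiv 𝓘(ℝ, F) 𝓘(ℝ, E) f y (X y))
      ((hJ.mdifferentiableAt hU hx α).comp x (hfs.mdifferentiable (by simp) x))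
      (hfs.mdifferentiableAt_mfderiv_apply hX)
  obtain ⟨Y, hY, hYe⟩ := (hf.isImmersion.isImmersionAt x).exists_lift hW
    (hex.mono fun y ⟨w, _, hw⟩ ↦ ⟨w, hw⟩)
  refine ⟨Y, hY, ?_, hYe⟩
  filter_upwards [hex, hYe] with y ⟨w, hw, e⟩ hy
  -- df is injective at `y`, because the induced form is nondegenerate.
  have h : Y y = w := by
    rw [← sub_eq_zero]
    refine hf.nondegenerate y _ fun v ↦ ?_
    rw [map_sub, hy, e, sub_self]
    simp
  rwa [h]

/-- `∇_X X` is orthogonal to the complement of the paraquaternionic distribution. -/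
theorem IsParaquaternionicCRSubmanifold.inner_leviCivita_eq_zero
    (hM : IsParaquaternionicKahler g σ) (hD : IsParaquaternionicCRSubmanifold g σ hf D)
    {X : Π x : N, TangentSpace 𝓘(ℝ, F) x} (hX : MDiffAt (T% X) x)
    (hXD : ∀ᶠ y in 𝓝 x, X y ∈ D.fiber y)
    {u : TangentSpace 𝓘(ℝ, F) x} (hu : u ∈ D.orthogonal (inducedMetric g hf) x) :
    (inducedMetric g hf).inner x ((inducedMetric g hf).leviCivita X x (X x)) u = 0 := by
  obtain ⟨U, hU, hx, J, hJ⟩ := σ.exists_basis (f x)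
  -- Indices start at 0: Y = J_3 X, Z = J_1 X, and Z = J_2 Y since J_2 J_3 = ε_1 J_1 = J_1.
  obtain ⟨Y, hY, hYD, hXY⟩ := hD.exists_field hU hJ hx 2 hX hXD
  obtain ⟨Z, hZ, hZD, hXZ⟩ := hD.exists_field hU hJ hx 0 hX hXD
  have hYZ : ∀ᶠ y in 𝓝 x, mfderiv 𝓘(ℝ, F) 𝓘(ℝ, E) f y (Z y) =
      J 1 (f y) (mfderiv 𝓘(ℝ, F) 𝓘(ℝ, E) f y (Y y)) := by
    filter_upwards [hXY, hXZ,
      hf.isImmersion.contMDiff.continuous.continuousAt (hU.mem_nhds hx)] with y h1 h2 hy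
    have h := hJ.mul (f y) hy 1 (mfderiv 𝓘(ℝ, F) 𝓘(ℝ, E) f y (X y))
    rw [h1, h2]
    refine Eq.trans ?_ h.symm
    simp [paraSign]
  have h1 := hD.inner_leviCivita_eq_neg hM hU hJ hx 2 hX hY hXD.self_of_nhds hXY hu
  have h2 := hD.inner_leviCivita_eq_neg hM hU hJ hx 1 hY hZ hYD.self_of_nhds hYZ hu
  have h3 := hD.inner_leviCivita_eq_neg hM hU hJ hx 0 hX hZ hXD.self_of_nhds hXZ hu
  simp only [paraSign, Matrix.cons_val] at h1 h2 h3
  -- With a, b, c the pairings for X, Y, Z: a = b, b = c and a = -c.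
  linarith

/-- The D^⊥-component is orthogonal to D automatically and to D^⊥ by assumption, so nondegeneracy of
`g` kills it. -/
theorem TangentDistribution.secondFundamentalForm_eq_zero {g : SemiRiemannianMetric F N}
    (hD : D.IsNondegenerate g) {X Y : Π x : N, TangentSpace 𝓘(ℝ, F) x}
    (h : ∀ u ∈ D.orthogonal g x, g.inner x (g.leviCivita Y x (X x)) u = 0) :
    D.secondFundamentalForm hD X Y x = 0 := by
  set v := g.leviCivita Y x (X x) with hv
  rw [secondFundamentalForm, ← hv, Submodule.projection_apply_eq_zero_iff]
  obtain ⟨a, ha, b, hb, hab⟩ := Submodule.mem_sup.1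
    ((hD.isCompl x).sup_eq_top ▸ Submodule.mem_top : v ∈ D.fiber x ⊔ D.orthogonal g x)
  have hb0 : b = 0 := by
    refine g.nondegenerate x b fun w ↦ ?_
    obtain ⟨c, hc, d, hd, rfl⟩ := Submodule.mem_sup.1
      ((hD.isCompl x).sup_eq_top ▸ Submodule.mem_top : w ∈ D.fiber x ⊔ D.orthogonal g x)
    have h1 : g.inner x c b = 0 := hb c hc
    have h2 : g.inner x a d = 0 := hd a ha
    have h3 := h d hd
    rw [← hab, map_add, add_apply, h2, zero_add] at h3
    rw [map_add, h3, g.symm, h1, add_zero]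
  rw [← hab, hb0, add_zero]
  exact ha

end CR

theorem mainTheorem3
    {E : Type*} [NormedAddCommGroup E] [NormedSpace ℝ E] [FiniteDimensional ℝ E]
    {M : Type*} [TopologicalSpace M] [ChartedSpace E M] [IsManifold 𝓘(ℝ, E) ∞ M]
    {F : Type*} [NormedAddCommGroup F] [NormedSpace ℝ F] [FiniteDimensional ℝ F]
    {N : Type*} [TopologicalSpace N] [ChartedSpace F N] [IsManifold 𝓘(ℝ, F) ∞ N]
    (g : SemiRiemannianMetric E M) (σ : AlmostParaquaternionicStructure E M)
    (hM : IsParaquaternionicKahler g σ)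
    (f : N → M) (hf : IsNondegenerateImmersion (F := F) g f)
    (D : TangentDistribution F N) (hD : IsParaquaternionicCRSubmanifold g σ hf D) :
    TangentDistribution.IsMinimal hD.nondegenerate ∧
      ∀ (U : Set N) (X : Π x : N, TangentSpace 𝓘(ℝ, F) x), IsOpen U → D.IsSectionOn U X →
        ∀ x ∈ U, TangentDistribution.secondFundamentalForm hD.nondegenerate X X x = 0 := by
  have key (U : Set N) (X : Π x : N, TangentSpace 𝓘(ℝ, F) x) (hU : IsOpen U)
      (hX : D.IsSectionOn U X) (x : N) (hx : x ∈ U) :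
      TangentDistribution.secondFundamentalForm hD.nondegenerate X X x = 0 :=
    TangentDistribution.secondFundamentalForm_eq_zero _ fun u hu ↦
      hD.inner_leviCivita_eq_zero hM
        ((hX.contMDiffOn.contMDiffAt (hU.mem_nhds hx)).mdifferentiableAt (by simp))
        (Filter.eventually_of_mem (hU.mem_nhds hx) hX.mem) hu
  -- Minimality holds term by term: the sum has only zero summands, which also covers q = 0.
  refine ⟨fun x U hU hx q e he _ ↦ ?_, key⟩
  simp [TangentDistribution.meanCurvatureVector, key U _ hU (he _) x hx]
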